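/- Let $\Bbbk$ be a field. A DG Poisson algebra is a unital associative $\mathbb{Z}$-graded $\Bbbk$-algebra $A$ with a $\Bbbk$-linear map $d:A\to A$ of degree $1$ and a $\Bbbk$-bilinear bracket $\{\cdot,\cdot\}:A\times A\to A$ of degree $0$ such that $d^2=0$ and, for all homogeneous $a,b,c\in A$, $$ab=(-1)^{|a||b|}ba,\qquad \{a,b\}=-(-1)^{|a||b|}\{b,a\},\qquad \{a,\{b,c\}\}=\{\{a,b\},c\}+(-1)^{|a||b|}\{b,\{a,c\}\},$$ $$\{a,bc\}=\{a,b\}c+(-1)^{|a||b|}b\{a,c\},\qquad d(ab)=d(a)b+(-1)^{|a|}a\,d(b),\qquad d\{a,b\}=\{d(a),b\}+(-1)^{|a|}\{a,d(b)\}.$$ A DG ideal of $A$ is a graded two-sided ideal $I$ with $d(I)\subseteq I$; it is a DG Poisson ideal if moreover $\{I,A\}\subseteq I$. A maximal DG ideal is a maximal element of the set of proper DG ideals. A DG Poisson ideal $P$ is called DG symplectic if there is a maximal DG ideal $M$ of $A$ such that $P$ is the largest DG Poisson ideal contained in $M$. A DG Poisson algebra map is a degree-$0$ homomorphism of $\Bbbk$-algebras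 that commutes with the differentials and the brackets. A (left) DG Poisson $A$-module is a $\mathbb{Z}$-graded left $A$-module $X$ with a $\Bbbk$-linear map $\partial:X\to X$ of degree $1$ and a $\Bbbk$-bilinear map $\{\cdot,\cdot\}_X:A\times X\to X$ of degree $0$ such that $\partial^2=0$ and, for all homogeneous $a,b\in A$ and $m\in X$, $$\partial(am)=d(a)m+(-1)^{|a|}a\,\partial(m),\qquad \partial\{a,m\}_X=\{d(a),m\}_X+(-1)^{|a|}\{a,\partial(m)\}_X,$$ $$\{a,bm\}_X=\{a,b\}m+(-1)^{|a||b|}b\{a,m\}_X,\qquad \{ab,m\}_X=a\{b,m\}_X+(-1)^{|a||b|}b\{a,m\}_X,$$ $$\{a,\{b,m\}_X\}_X=\{\{a,b\},m\}_X+(-1)^{|a||b|}\{b,\{a,m\}_X\}_X.$$ It is simple if $X\neq 0$ and the only graded $A$-submodules $N\subseteq X$ with $\partial(N)\subseteq N$ and $\{A,N\}_X\subseteq N$ are $0$ and $X$. Its annihilator is $\{a\in A: aX=0\}$. Let $V$ be a graded $\Bbbk$-vector space with a homogeneous basis $(x_\alpha)_{\alpha\in\Lambda}$, let $$R=T(V)/\langle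 x_\alpha\otimes x_\beta-(-1)^{|x_\alpha||x_\beta|}x_\beta\otimes x_\alpha : \alpha,\beta\in\Lambda\rangle$$ with the induced grading, and let $R$ carry an arbitrary differential and bracket that make it a DG Poisson algebra. Let $A$ be a DG Poisson homomorphic image of $R$, that is, a DG Poisson algebra with a surjective DG Poisson algebra map $R\to A$ (equivalently, $A\cong R/I$ for a DG Poisson ideal $I$ of $R$). Then every DG symplectic ideal $P$ of $A$ is the annihilator of a simple DG Poisson $A$-module. -/

import Mathlib

universe u v w

open DirectSum

/-! ### The graded-commutative polynomial algebra -/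

/-- The defining relations `x_α x_β = (-1)^(|x_α||x_β|) x_β x_α` on the free algebra
(the tensor algebra of the vector space with basis `Λ`). -/
inductive GradedPoly.Rel (k : Type*) [Field k] {Λ : Type*} (deg : Λ → ℤ) :
    FreeAlgebra k Λ → FreeAlgebra k Λ → Prop
  | comm (α β : Λ) : GradedPoly.Rel k deg (FreeAlgebra.ι k α * FreeAlgebra.ι k β)
      ((deg α * deg β).negOnePow • (FreeAlgebra.ι k β * FreeAlgebra.ι k α))

/-- The graded-commutative polynomial algebra over `k` on generators `x_α` (`α : Λ`) of
degrees `deg α`: the tensor algebra modulo `x_α x_β - (-1)^(|x_α||x_β|) x_β x_α`. -/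
def GradedPoly (k : Type*) [Field k] {Λ : Type*} (deg : Λ → ℤ) : Type _ :=
  RingQuot (GradedPoly.Rel k deg)

namespace GradedPoly

section

variable (k : Type*) [Field k] {Λ : Type*} (deg : Λ → ℤ)

noncomputable instance : Ring (GradedPoly k deg) :=
  inferInstanceAs (Ring (RingQuot (GradedPoly.Rel k deg)))

noncomputable instance : Algebra k (GradedPoly k deg) :=
  inferInstanceAs (Algebra k (RingQuot (GradedPoly.Rel k deg)))

/-- The canonical projection from the free algebra. -/
noncomputable def mk : FreeAlgebra k Λ →ₐ[k] GradedPoly k deg :=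
  RingQuot.mkAlgHom k (GradedPoly.Rel k deg)

/-- The generator `x_α`. -/
noncomputable def X (α : Λ) : GradedPoly k deg :=
  mk k deg (FreeAlgebra.ι k α)

/-- The homogeneous component of degree `n`: the span of the monomials
`x_{α₁} ⋯ x_{α_r}` with `|x_{α₁}| + ⋯ + |x_{α_r}| = n`. -/
noncomputable def grading (n : ℤ) : Submodule k (GradedPoly k deg) :=
  Submodule.span k {x | ∃ l : List Λ, (l.map deg).sum = n ∧ (l.map (X k deg)).prod = x}

variable {k deg}

theorem X_mem (α : Λ) : X k deg α ∈ grading k deg (deg α) :=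
  Submodule.subset_span ⟨[α], by simp, by simp⟩

instance : SetLike.GradedMonoid (grading k deg) where
  one_mem := Submodule.subset_span ⟨[], by simp, by simp⟩
  mul_mem i j x y hx hy := by
    have h : grading k deg i * grading k deg j ≤ grading k deg (i + j) := by
      unfold grading
      rw [Submodule.span_mul_span]
      refine Submodule.span_mono ?_
      rintro _ ⟨_, ⟨l, hl, rfl⟩, _, ⟨l', hl', rfl⟩, rfl⟩
      exact ⟨l ++ l', by simp [hl, hl'], by simp⟩
    exact h (Submodule.mul_mem_mul hx hy)

theorem X_mul_X (α β : Λ) :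
    X k deg α * X k deg β = (deg α * deg β).negOnePow • (X k deg β * X k deg α) := by
  have h := RingQuot.mkAlgHom_rel k (GradedPoly.Rel.comm (k := k) (deg := deg) α β)
  have h' : mk k deg (FreeAlgebra.ι k α * FreeAlgebra.ι k β) =
      mk k deg ((deg α * deg β).negOnePow • (FreeAlgebra.ι k β * FreeAlgebra.ι k α)) := h
  rw [map_mul, Units.smul_def, map_zsmul, map_mul, ← Units.smul_def] at h'
  exact h'

variable (k deg) in
/-- The decomposition into homogeneous components, as an algebra map. -/
noncomputable def decomp : GradedPoly k deg →ₐ[k] ⨁ i, grading k deg i :=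
  RingQuot.liftAlgHom k (s := GradedPoly.Rel k deg) ⟨FreeAlgebra.lift k fun α =>
    DirectSum.of (fun i => grading k deg i) (deg α) ⟨X k deg α, X_mem α⟩, by
      rintro _ _ ⟨α, β⟩
      rw [Units.smul_def, map_zsmul, map_mul, map_mul, FreeAlgebra.lift_ι_apply,
        FreeAlgebra.lift_ι_apply, DirectSum.of_mul_of, DirectSum.of_mul_of, ← map_zsmul]
      refine DirectSum.of_eq_of_gradedMonoid_eq (Sigma.subtype_ext (add_comm _ _) ?_)
      exact (X_mul_X α β).trans (Units.smul_def _ _)⟩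

theorem decomp_X (α : Λ) : decomp k deg (X k deg α) =
    DirectSum.of (fun i => grading k deg i) (deg α) ⟨X k deg α, X_mem α⟩ := by
  have h : decomp k deg (mk k deg (FreeAlgebra.ι k α)) = _ :=
    RingQuot.liftAlgHom_mkAlgHom_apply k _ _ _
  rw [FreeAlgebra.lift_ι_apply] at h
  exact h

theorem mk_surjective : Function.Surjective (mk k deg) :=
  RingQuot.mkAlgHom_surjective k _

theorem prod_mem (l : List Λ) :
    (l.map (X k deg)).prod ∈ grading k deg (l.map deg).sum :=
  Submodule.subset_span ⟨l, rfl, rfl⟩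

theorem decomp_prod (l : List Λ) : decomp k deg (l.map (X k deg)).prod =
    DirectSum.of (fun i => grading k deg i) (l.map deg).sum ⟨_, prod_mem l⟩ := by
  induction l with
  | nil => exact (map_one (decomp k deg)).trans (DirectSum.one_def (fun i => grading k deg i))
  | cons α l ih =>
    have h : decomp k deg ((α :: l).map (X k deg)).prod =
        decomp k deg (X k deg α) * decomp k deg (l.map (X k deg)).prod := by
      rw [List.map_cons, List.prod_cons, map_mul]
    rw [h, ih, decomp_X, DirectSum.of_mul_of]
    exact DirectSum.of_eq_of_gradedMonoid_eq (Sigma.subtype_ext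
      (List.sum_cons (a := deg α) (l := l.map deg)).symm
      (List.prod_cons (a := X k deg α) (l := l.map (X k deg))).symm)

noncomputable instance : GradedAlgebra (grading k deg) :=
  GradedAlgebra.ofAlgHom _ (decomp k deg)
    (by
      have h : ((DirectSum.coeAlgHom (grading k deg)).comp (decomp k deg)).comp (mk k deg) =
          (AlgHom.id k (GradedPoly k deg)).comp (mk k deg) := by
        refine FreeAlgebra.hom_ext ?_
        funext α
        change DirectSum.coeAlgHom (grading k deg) (decomp k deg (X k deg α)) = X k deg α
        rw [decomp_X, DirectSum.coeAlgHom_of]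
      ext x
      obtain ⟨y, rfl⟩ := mk_surjective x
      exact DFunLike.congr_fun h y)
    (by
      rintro i ⟨x, hx⟩
      dsimp only
      unfold grading at hx
      induction hx using Submodule.span_induction with
      | mem x h =>
        obtain ⟨l, rfl, rfl⟩ := h
        exact decomp_prod l
      | zero => rw [map_zero]; exact (map_zero _).symm
      | add x y hx hy ihx ihy =>
        rw [map_add, ihx, ihy, ← map_add]; rfl
      | smul c x hx ih =>
        rw [map_smul, ih, ← DirectSum.lof_eq_of k, ← map_smul]; rfl)

end

end GradedPoly

/-! ### DG Poisson algebras, DG ideals, DG Poisson ideals -/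

/-- A DG Poisson algebra structure on the `ℤ`-graded algebra `A = ⨁ 𝒜 i`: a differential of
degree `1` and a bracket of degree `0`.  The product is graded commutative. -/
structure DGPoisson {k A : Type*} [Field k] [Ring A] [Algebra k A]
    (𝒜 : ℤ → Submodule k A) [GradedAlgebra 𝒜] where
  /-- the differential -/
  d : A →ₗ[k] A
  /-- the Poisson bracket -/
  br : A →ₗ[k] A →ₗ[k] A
  d_mem : ∀ {i : ℤ} {a : A}, a ∈ 𝒜 i → d a ∈ 𝒜 (i + 1)
  br_mem : ∀ {i j : ℤ} {a b : A}, a ∈ 𝒜 i → b ∈ 𝒜 j → br a b ∈ 𝒜 (i + j)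
  antisymm : ∀ {i j : ℤ} {a b : A}, a ∈ 𝒜 i → b ∈ 𝒜 j →
    br a b = -((i * j).negOnePow • br b a)
  jacobi : ∀ {i j l : ℤ} {a b c : A}, a ∈ 𝒜 i → b ∈ 𝒜 j → c ∈ 𝒜 l →
    br a (br b c) = br (br a b) c + (i * j).negOnePow • br b (br a c)
  comm : ∀ {i j : ℤ} {a b : A}, a ∈ 𝒜 i → b ∈ 𝒜 j →
    a * b = (i * j).negOnePow • (b * a)
  br_mul : ∀ {i j l : ℤ} {a b c : A}, a ∈ 𝒜 i → b ∈ 𝒜 j → c ∈ 𝒜 l →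
    br a (b * c) = br a b * c + (i * j).negOnePow • (b * br a c)
  d_d : ∀ a : A, d (d a) = 0
  d_br : ∀ {i j : ℤ} {a b : A}, a ∈ 𝒜 i → b ∈ 𝒜 j →
    d (br a b) = br (d a) b + i.negOnePow • br a (d b)
  d_mul : ∀ {i j : ℤ} {a b : A}, a ∈ 𝒜 i → b ∈ 𝒜 j →
    d (a * b) = d a * b + i.negOnePow • (a * d b)

namespace DGPoisson

section

variable {k A B : Type*} [Field k] [Ring A] [Algebra k A] [Ring B] [Algebra k B]
  {𝒜 : ℤ → Submodule k A} [GradedAlgebra 𝒜] {ℬ : ℤ → Submodule k B} [GradedAlgebra ℬ]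

/-- A DG ideal: a graded two-sided ideal stable under the differential. -/
structure IsDGIdeal (S : DGPoisson 𝒜) (I : Ideal A) : Prop where
  isTwoSided : I.IsTwoSided
  isHomogeneous : I.IsHomogeneous 𝒜
  d_mem : ∀ a ∈ I, S.d a ∈ I

/-- A DG Poisson ideal: a DG ideal `I` with `{I, A} ⊆ I`. -/
structure IsDGPoissonIdeal (S : DGPoisson 𝒜) (I : Ideal A) : Prop
    extends S.IsDGIdeal I where
  br_mem : ∀ a ∈ I, ∀ b : A, S.br a b ∈ I

/-- A maximal DG ideal: maximal among the proper DG ideals. -/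
def IsMaximalDGIdeal (S : DGPoisson 𝒜) (M : Ideal A) : Prop :=
  Maximal (fun J : Ideal A => S.IsDGIdeal J ∧ J ≠ ⊤) M

/-- A DG symplectic ideal: the largest DG Poisson ideal contained in some maximal DG ideal. -/
def IsSymplectic (S : DGPoisson 𝒜) (P : Ideal A) : Prop :=
  ∃ M : Ideal A, S.IsMaximalDGIdeal M ∧
    IsGreatest {Q : Ideal A | S.IsDGPoissonIdeal Q ∧ Q ≤ M} P

/-- A DG Poisson algebra map: an algebra map of degree `0` commuting with the differentials and
the brackets. -/
structure IsHom (S : DGPoisson 𝒜) (T : DGPoisson ℬ) (f : A →ₐ[k] B) : Prop where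
  map_mem : ∀ {i : ℤ} {a : A}, a ∈ 𝒜 i → f a ∈ ℬ i
  map_d : ∀ a : A, f (S.d a) = T.d (f a)
  map_br : ∀ a b : A, f (S.br a b) = T.br (f a) (f b)

end

end DGPoisson

/-! ### DG Poisson modules -/

/-- A left DG Poisson module structure over the DG Poisson algebra `(A, S)` on the graded left
`A`-module `X = ⨁ ℳ i`. -/
structure DGPoissonModule {k A X : Type*} [Field k] [Ring A] [Algebra k A]
    {𝒜 : ℤ → Submodule k A} [GradedAlgebra 𝒜] (S : DGPoisson 𝒜)
    [AddCommGroup X] [Module k X] [Module A X] [IsScalarTower k A X]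
    (ℳ : ℤ → Submodule k X) [DirectSum.Decomposition ℳ] [SetLike.GradedSMul 𝒜 ℳ] where
  /-- the differential -/
  d : X →ₗ[k] X
  /-- the bracket `{a, m}` -/
  br : A →ₗ[k] X →ₗ[k] X
  d_mem : ∀ {i : ℤ} {m : X}, m ∈ ℳ i → d m ∈ ℳ (i + 1)
  br_mem : ∀ {i j : ℤ} {a : A} {m : X}, a ∈ 𝒜 i → m ∈ ℳ j → br a m ∈ ℳ (i + j)
  d_d : ∀ m : X, d (d m) = 0
  d_smul : ∀ {i j : ℤ} {a : A} {m : X}, a ∈ 𝒜 i → m ∈ ℳ j →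
    d (a • m) = S.d a • m + i.negOnePow • (a • d m)
  br_smul : ∀ {i j l : ℤ} {a b : A} {m : X}, a ∈ 𝒜 i → b ∈ 𝒜 j → m ∈ ℳ l →
    br a (b • m) = S.br a b • m + (i * j).negOnePow • (b • br a m)
  mul_br : ∀ {i j l : ℤ} {a b : A} {m : X}, a ∈ 𝒜 i → b ∈ 𝒜 j → m ∈ ℳ l →
    br (a * b) m = a • br b m + (i * j).negOnePow • (b • br a m)
  br_br : ∀ {i j l : ℤ} {a b : A} {m : X}, a ∈ 𝒜 i → b ∈ 𝒜 j → m ∈ ℳ l →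
    br a (br b m) = br (S.br a b) m + (i * j).negOnePow • br b (br a m)
  d_br : ∀ {i j : ℤ} {a : A} {m : X}, a ∈ 𝒜 i → m ∈ ℳ j →
    d (br a m) = br (S.d a) m + i.negOnePow • br a (d m)

namespace DGPoissonModule

section

variable {k A X : Type*} [Field k] [Ring A] [Algebra k A]
  {𝒜 : ℤ → Submodule k A} [GradedAlgebra 𝒜] {S : DGPoisson 𝒜}
  [AddCommGroup X] [Module k X] [Module A X] [IsScalarTower k A X]
  {ℳ : ℤ → Submodule k X} [DirectSum.Decomposition ℳ] [SetLike.GradedSMul 𝒜 ℳ]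

/-- A DG Poisson submodule: a graded submodule stable under the differential and under the
brackets with elements of `A`. -/
structure IsDGPoissonSubmodule (D : DGPoissonModule S ℳ) (N : Submodule A X) : Prop where
  isHomogeneous : N.IsHomogeneous ℳ
  d_mem : ∀ m ∈ N, D.d m ∈ N
  br_mem : ∀ a : A, ∀ m ∈ N, D.br a m ∈ N

/-- A simple DG Poisson module: nonzero, and without nonzero proper DG Poisson submodules. -/
structure IsSimple (D : DGPoissonModule S ℳ) : Prop where
  nontrivial : Nontrivial X
  eq_bot_or_eq_top : ∀ N : Submodule A X, D.IsDGPoissonSubmodule N → N = ⊥ ∨ N = ⊤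

end

end DGPoissonModule

/-! The simple module is found inside the graded dual of $A$. Precomposition with multiplication by
$b$ and with $\{\cdot,b\}$ gives functionals on $A$ an action and a bracket, and a signed transpose
of $d$ gives a differential; Leibniz, Jacobi and graded commutativity in $A$ then become the module
axioms (`DGPoisson.dualModule`).

Let $M$ be a maximal DG ideal and $P$ the largest DG Poisson ideal inside it. Some functional
$\varphi$ of degree $0$ kills $M$ but not $1$. Either $\varphi$ is closed, or $\partial\varphi$ is
nonzero, closed and, since $d(M)\subseteq M$, still kills $M$. In both cases there is a nonzero
closed homogeneous $\psi$ with $M\psi=0$ (`DGPoisson.exists_closed_dual`).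

Zorn's lemma gives a DG Poisson submodule $L$ maximal among those missing $\psi$. Every nonzero DG
Poisson submodule of the quotient by $L$ contains the class of $\psi$, so the intersection of them
all is a simple module $W$ containing that class (`DGPoissonModule.exists_simple_of_closed`).

The annihilator of $W$ is $P$ (`DGPoissonModule.IsSimple.annihilator_eq`). Because $\psi$ is closed,
the annihilator of its class is a DG ideal; it is proper and contains $M$, hence equals $M$. So
$\mathrm{Ann}(W)$ is a DG Poisson ideal inside $M$, and lies in $P$. Conversely, the elements of $W$
killed by $P$ form a DG Poisson submodule containing the class of $\psi$, hence are all of $W$. -/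

/-! ### Graded modules -/

section Graded

variable {k X Y : Type*} [Field k] [AddCommGroup X] [Module k X] [AddCommGroup Y] [Module k Y]

/-- A linear map of degree `0` commutes with taking homogeneous components. -/
theorem DirectSum.coe_decompose_map {ℳ : ℤ → Submodule k X} [Decomposition ℳ]
    {𝒩 : ℤ → Submodule k Y} [Decomposition 𝒩] (f : X →ₗ[k] Y)
    (hf : ∀ {i : ℤ} {x : X}, x ∈ ℳ i → f x ∈ 𝒩 i) (x : X) (i : ℤ) :
    (decompose 𝒩 (f x) i : Y) = f (decompose ℳ x i) := by
  induction x using Decomposition.inductionOn ℳ with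
  | zero => simp
  | @homogeneous j m =>
    by_cases h : j = i
    · subst h
      rw [decompose_of_mem_same _ (hf m.2), decompose_of_mem_same _ m.2]
    · rw [decompose_of_mem_ne _ (hf m.2) h, decompose_of_mem_ne _ m.2 h, map_zero]
  | add x y hx hy => simp [decompose_add, hx, hy]

/-- A spanning family of submodules which is separated by linear projections is a
decomposition. -/
@[reducible]
noncomputable def DirectSum.Decomposition.ofProj (ℳ : ℤ → Submodule k X) (p : ℤ → X →ₗ[k] X)
    (hp : ∀ {i : ℤ} {x : X}, x ∈ ℳ i → p i x = x)
    (hp' : ∀ {i j : ℤ} {x : X}, x ∈ ℳ j → j ≠ i → p i x = 0) (htop : ⨆ i, ℳ i = ⊤) :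
    Decomposition ℳ :=
  IsInternal.chooseDecomposition ℳ <| by
    rw [isInternal_submodule_iff_iSupIndep_and_iSup_eq_top]
    refine ⟨fun i => Submodule.disjoint_def.2 fun x hx hx' => ?_, htop⟩
    -- `p i` is the identity on piece `i` and kills the span of the other pieces, so the
    -- intersection is zero.
    have h : (⨆ (j : ℤ) (_ : j ≠ i), ℳ j) ≤ LinearMap.ker (p i) :=
      iSup₂_le fun j hj y hy => hp' hy hj
    rw [← hp hx]
    exact h hx'

/-- The projection onto the homogeneous component of degree `i`. -/
noncomputable def DirectSum.componentMap (ℳ : ℤ → Submodule k X) [Decomposition ℳ] (i : ℤ) :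
    X →ₗ[k] X :=
  (ℳ i).subtype ∘ₗ DirectSum.component k ℤ (fun i => ℳ i) i ∘ₗ
    (decomposeLinearEquiv ℳ).toLinearMap

theorem DirectSum.componentMap_apply (ℳ : ℤ → Submodule k X) [Decomposition ℳ] (i : ℤ) (x : X) :
    componentMap ℳ i x = decompose ℳ x i := rfl

variable {A : Type*} [Ring A] [Module A X] {ℳ : ℤ → Submodule k X} [Decomposition ℳ]

/-- To prove an additive property of the elements of a homogeneous submodule it suffices to
consider homogeneous elements. -/
theorem Submodule.IsHomogeneous.induction {N : Submodule A X} (hN : N.IsHomogeneous ℳ)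
    {motive : X → Prop} (zero : motive 0) (add : ∀ x y, motive x → motive y → motive (x + y))
    (homogeneous : ∀ (i : ℤ) (x : X), x ∈ ℳ i → x ∈ N → motive x) {x : X} (hx : x ∈ N) :
    motive x := by
  classical
  rw [← sum_support_decompose ℳ x]
  exact Finset.sum_induction _ motive (fun _ _ => add _ _) zero
    fun i _ => homogeneous i _ (decompose ℳ x i).2 (hN i hx)

theorem Submodule.IsHomogeneous.sInf {𝒮 : Set (Submodule A X)}
    (h : ∀ N ∈ 𝒮, N.IsHomogeneous ℳ) : (sInf 𝒮).IsHomogeneous ℳ := fun i _ hx =>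
  Submodule.mem_sInf.2 fun N hN => h N hN i (Submodule.mem_sInf.1 hx N hN)

variable [Algebra k A] {𝒜 : ℤ → Submodule k A} [SetLike.GradedSMul 𝒜 ℳ]

/-- A homogeneous scalar only shifts components, so if it kills `x` it kills each component of `x`.
This makes the submodule killed by a homogeneous ideal homogeneous. -/
theorem DirectSum.coe_decompose_smul_of_left_mem {i : ℤ} {a : A} (ha : a ∈ 𝒜 i) (x : X) (j : ℤ) :
    (decompose ℳ (a • x) (i + j) : X) = a • (decompose ℳ x j : X) := by
  induction x using Decomposition.inductionOn ℳ with
  | zero => simp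
  | @homogeneous l m =>
    have hm : a • (m : X) ∈ ℳ (i + l) := SetLike.GradedSMul.smul_mem ha m.2
    by_cases h : l = j
    · subst h
      rw [decompose_of_mem_same _ hm, decompose_of_mem_same _ m.2]
    · rw [decompose_of_mem_ne _ hm (by simpa using h), decompose_of_mem_ne _ m.2 h, smul_zero]
  | add x y hx hy => simp [decompose_add, hx, hy, smul_add]

/-- The mirror image: it makes annihilators of homogeneous elements homogeneous. -/
theorem DirectSum.coe_decompose_smul_of_right_mem [GradedAlgebra 𝒜] {j : ℤ} {x : X} (hx : x ∈ ℳ j)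
    (a : A) (i : ℤ) :
    (decompose ℳ (a • x) (i + j) : X) = (decompose 𝒜 a i : A) • x := by
  induction a using Decomposition.inductionOn 𝒜 with
  | zero => simp
  | @homogeneous l m =>
    have hm : (m : A) • x ∈ ℳ (l + j) := SetLike.GradedSMul.smul_mem m.2 hx
    by_cases h : l = i
    · subst h
      rw [decompose_of_mem_same _ hm, decompose_of_mem_same _ m.2]
    · rw [decompose_of_mem_ne _ hm (by simpa using h), decompose_of_mem_ne _ m.2 h, zero_smul]
  | add x y hx hy => simp [decompose_add, hx, hy, add_smul]

end Graded

/-! ### Annihilators of simple DG Poisson modules -/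

section Annihilator

variable {k A X : Type*} [Field k] [Ring A] [Algebra k A]
  {𝒜 : ℤ → Submodule k A} [GradedAlgebra 𝒜] {S : DGPoisson 𝒜}
  [AddCommGroup X] [Module k X] [Module A X] [IsScalarTower k A X]
  {ℳ : ℤ → Submodule k X} [DirectSum.Decomposition ℳ] [SetLike.GradedSMul 𝒜 ℳ]

/-- Homogeneous left ideals of a DG Poisson algebra are two-sided. -/
theorem DGPoisson.isTwoSided (S : DGPoisson 𝒜) {I : Ideal A} (hI : I.IsHomogeneous 𝒜) :
    I.IsTwoSided := by
  refine ⟨fun {a} b ha => ?_⟩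
  refine Submodule.IsHomogeneous.induction (ℳ := 𝒜) hI (motive := fun a => a * b ∈ I) (by simp)
    (fun x y hx hy => by rw [add_mul]; exact I.add_mem hx hy) (fun i a hai ha => ?_) ha
  induction b using Decomposition.inductionOn 𝒜 with
  | zero => simp
  | homogeneous b =>
    rw [S.comm hai b.2, Units.smul_def]
    exact zsmul_mem (I.mul_mem_left _ ha) _
  | add x y hx hy => rw [mul_add]; exact I.add_mem hx hy

namespace DGPoissonModule

variable (D : DGPoissonModule S ℳ)

/-- The sign involves only the degree of `a`, and both sides are additive in `m`, so `m` need not be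
homogeneous. -/
theorem d_smul_of_mem {i : ℤ} {a : A} (ha : a ∈ 𝒜 i) (m : X) :
    D.d (a • m) = S.d a • m + i.negOnePow • (a • D.d m) := by
  induction m using Decomposition.inductionOn ℳ with
  | zero => simp
  | homogeneous m => exact D.d_smul ha m.2
  | add x y hx hy => simp only [smul_add, map_add, hx, hy]; abel

theorem br_smul_of_mem {i j : ℤ} {a b : A} (ha : a ∈ 𝒜 i) (hb : b ∈ 𝒜 j) (m : X) :
    D.br a (b • m) = S.br a b • m + (i * j).negOnePow • (b • D.br a m) := by
  induction m using Decomposition.inductionOn ℳ with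
  | zero => simp
  | homogeneous m => exact D.br_smul ha hb m.2
  | add x y hx hy => simp only [smul_add, map_add, hx, hy]; abel

/-- The annihilator of a DG Poisson module is a DG Poisson ideal. -/
theorem isDGPoissonIdeal_annihilator (D : DGPoissonModule S ℳ) :
    S.IsDGPoissonIdeal (Module.annihilator A X) := by
  have hom : (Module.annihilator A X).IsHomogeneous 𝒜 := fun i a ha => by
    rw [Module.mem_annihilator] at ha ⊢
    intro x
    induction x using Decomposition.inductionOn ℳ with
    | zero => simp
    | homogeneous m => rw [← coe_decompose_smul_of_right_mem m.2 a i, ha]; simp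
    | add x y hx hy => rw [smul_add, hx, hy, add_zero]
  refine ⟨⟨S.isTwoSided hom, hom, fun a ha => ?_⟩, fun a ha b => ?_⟩
  · refine Submodule.IsHomogeneous.induction (ℳ := 𝒜) hom
      (motive := fun a => S.d a ∈ Module.annihilator A X) (by simp)
      (fun x y hx hy => by rw [map_add]; exact add_mem hx hy) (fun i a hai ha => ?_) ha
    rw [Module.mem_annihilator] at ha ⊢
    intro m
    -- Both $am$ and $a\,\partial m$ vanish, so the Leibniz rule leaves $d(a)m=0$.
    simpa [ha] using (D.d_smul_of_mem hai m).symm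
  · refine Submodule.IsHomogeneous.induction (ℳ := 𝒜) hom
      (motive := fun a => S.br a b ∈ Module.annihilator A X) (by simp)
      (fun x y hx hy => by rw [map_add]; exact add_mem hx hy) (fun i a hai ha => ?_) ha
    rw [Module.mem_annihilator] at ha
    induction b using Decomposition.inductionOn 𝒜 with
    | zero => simp
    | homogeneous b =>
      -- The module axiom for $\{b,am\}$ controls $\{b,a\}m$, with the bracket in the opposite
      -- order.
      rw [S.antisymm hai b.2, Units.smul_def]
      refine neg_mem (zsmul_mem (Module.mem_annihilator.2 fun m => ?_) _)
      simpa [ha] using (D.br_smul_of_mem b.2 hai m).symm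
    | add x y hx hy => rw [map_add]; exact add_mem hx hy

/-- The annihilator of a closed homogeneous element is a DG ideal. -/
theorem isDGIdeal_torsionOf {j : ℤ} {ψ : X} (hψ : ψ ∈ ℳ j) (hd : D.d ψ = 0) :
    S.IsDGIdeal (Ideal.torsionOf A X ψ) := by
  have hom : (Ideal.torsionOf A X ψ).IsHomogeneous 𝒜 := fun i a ha => by
    rw [Ideal.mem_torsionOf_iff] at ha ⊢
    rw [← coe_decompose_smul_of_right_mem hψ a i, ha]; simp
  refine ⟨S.isTwoSided hom, hom, fun a ha => ?_⟩
  refine Submodule.IsHomogeneous.induction (ℳ := 𝒜) hom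
    (motive := fun a => S.d a ∈ Ideal.torsionOf A X ψ) (by simp)
    (fun x y hx hy => by rw [map_add]; exact add_mem hx hy) (fun i a hai ha => ?_) ha
  rw [Ideal.mem_torsionOf_iff] at ha ⊢
  -- Closedness enters here: $d(a)\psi=\partial(a\psi)\mp a\,\partial\psi$, and both terms vanish.
  simpa [ha, hd] using (D.d_smul_of_mem hai ψ).symm

theorem IsDGPoissonSubmodule.sInf {𝒮 : Set (Submodule A X)}
    (h : ∀ N ∈ 𝒮, D.IsDGPoissonSubmodule N) : D.IsDGPoissonSubmodule (sInf 𝒮) where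
  isHomogeneous := .sInf fun N hN => (h N hN).isHomogeneous
  d_mem m hm := Submodule.mem_sInf.2 fun N hN =>
    (h N hN).d_mem m (Submodule.mem_sInf.1 hm N hN)
  br_mem a m hm := Submodule.mem_sInf.2 fun N hN =>
    (h N hN).br_mem a m (Submodule.mem_sInf.1 hm N hN)

/-- The elements killed by a two-sided ideal. -/
def killedBy (X : Type*) [AddCommGroup X] [Module A X] (I : Ideal A) [I.IsTwoSided] :
    Submodule A X where
  carrier := {x | ∀ a ∈ I, a • x = 0}
  zero_mem' a _ := smul_zero a
  add_mem' hx hy a ha := by rw [smul_add, hx a ha, hy a ha, add_zero]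
  smul_mem' b x hx a ha := by
    rw [← mul_smul]
    exact hx _ (I.mul_mem_right b ha)

theorem mem_killedBy_of_homogeneous {I : Ideal A} [I.IsTwoSided] (hI : I.IsHomogeneous 𝒜) {x : X}
    (h : ∀ (i : ℤ) (a : A), a ∈ 𝒜 i → a ∈ I → a • x = 0) : x ∈ killedBy X I := fun _ ha =>
  Submodule.IsHomogeneous.induction (ℳ := 𝒜) hI (motive := fun a => a • x = 0) (zero_smul _ _)
    (fun a b ha hb => by rw [add_smul, ha, hb, add_zero]) h ha

/-- The elements killed by a DG Poisson ideal form a DG Poisson submodule. -/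
theorem isDGPoissonSubmodule_killedBy {I : Ideal A} [I.IsTwoSided] (hI : S.IsDGPoissonIdeal I) :
    D.IsDGPoissonSubmodule (killedBy X I) where
  isHomogeneous j x hx := mem_killedBy_of_homogeneous hI.isHomogeneous fun i a hai ha => by
    rw [← coe_decompose_smul_of_left_mem hai, hx a ha]; simp
  d_mem x hx := mem_killedBy_of_homogeneous hI.isHomogeneous fun i a hai ha => by
    have h := D.d_smul_of_mem hai x
    -- As $ax=0$ and $d(a)x=0$, the Leibniz rule reduces to $0=\pm a\,\partial x$.
    rw [hx a ha, hx _ (hI.d_mem a ha), map_zero, zero_add] at h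
    rwa [eq_comm, smul_eq_zero_iff_eq] at h
  br_mem b x hx := mem_killedBy_of_homogeneous hI.isHomogeneous fun i a hai ha => by
    induction b using Decomposition.inductionOn 𝒜 with
    | zero => simp
    | homogeneous b =>
      have hba : S.br b a ∈ I := by
        rw [S.antisymm b.2 hai, Units.smul_def]
        exact neg_mem (zsmul_mem (hI.br_mem a ha _) _)
      have h := D.br_smul_of_mem b.2 hai x
      rw [hx a ha, hx _ hba, map_zero, zero_add] at h
      rwa [eq_comm, smul_eq_zero_iff_eq] at h
    | add b c hb hc => rw [map_add, LinearMap.add_apply, smul_add, hb, hc, add_zero]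

/-- A simple DG Poisson module with a nonzero closed homogeneous element killed by the maximal DG
ideal `M` has the largest DG Poisson ideal in `M` as its annihilator. -/
theorem IsSimple.annihilator_eq {D : DGPoissonModule S ℳ} (hD : D.IsSimple) {M P : Ideal A}
    (hM : S.IsMaximalDGIdeal M) (hP : IsGreatest {Q : Ideal A | S.IsDGPoissonIdeal Q ∧ Q ≤ M} P)
    {j : ℤ} {ψ : X} (hψ : ψ ∈ ℳ j) (hd : D.d ψ = 0) (hψ0 : ψ ≠ 0) (hMψ : ∀ a ∈ M, a • ψ = 0) :
    P = Module.annihilator A X := by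
  have htor : Ideal.torsionOf A X ψ = M := by
    -- The annihilator of `ψ` contains `M` and is a DG ideal; it misses `1` since `ψ ≠ 0`.
    -- Maximality of `M` gives equality.
    refine (hM.eq_of_le ⟨D.isDGIdeal_torsionOf hψ hd, fun h => hψ0 ?_⟩ fun a ha => hMψ a ha).symm
    have h1 : (1 : A) ∈ Ideal.torsionOf A X ψ := h ▸ Submodule.mem_top
    rwa [Ideal.mem_torsionOf_iff, one_smul] at h1
  refine le_antisymm ?_ (hP.2 ⟨D.isDGPoissonIdeal_annihilator, fun a ha => ?_⟩)
  · have := hP.1.1.isTwoSided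
    have hψK : ψ ∈ killedBy X P := fun a ha => hMψ a (hP.1.2 ha)
    rcases hD.eq_bot_or_eq_top _ (D.isDGPoissonSubmodule_killedBy hP.1.1) with h | h
    · rw [h] at hψK
      exact absurd hψK hψ0
    · refine fun a ha => Module.mem_annihilator.2 fun x => ?_
      have hx : x ∈ killedBy X P := h ▸ Submodule.mem_top
      exact hx a ha
  · rw [← htor]
    exact Module.mem_annihilator.1 ha ψ

end DGPoissonModule

end Annihilator

/-! ### Submodules and quotients of DG Poisson modules -/

namespace DGPoissonModule

section Subquotient

variable {k A X : Type*} [Field k] [Ring A] [Algebra k A]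
  {𝒜 : ℤ → Submodule k A} [GradedAlgebra 𝒜] {S : DGPoisson 𝒜}
  [AddCommGroup X] [Module k X] [Module A X] [IsScalarTower k A X]

section Sub

variable (ℳ : ℤ → Submodule k X) (W : Submodule A X)

/-- The grading induced on a submodule. -/
def subGrading (i : ℤ) : Submodule k W := (ℳ i).comap (W.subtype.restrictScalars k)

instance [SetLike.GradedSMul 𝒜 ℳ] : SetLike.GradedSMul 𝒜 (subGrading ℳ W) where
  smul_mem _ _ _ m ha hm := SetLike.GradedSMul.smul_mem (A := 𝒜) (B := ℳ) (bj := (m : X)) ha hm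

variable [Decomposition ℳ] {W}

/-- The decomposition of a homogeneous submodule. -/
@[reducible]
noncomputable def subDecomposition (hW : W.IsHomogeneous ℳ) : Decomposition (subGrading ℳ W) :=
  .ofProj _ (fun i => (componentMap ℳ i).restrict (p := W.restrictScalars k)
      (q := W.restrictScalars k) fun _ hx => hW i hx)
    (fun hx => Subtype.ext (decompose_of_mem_same ℳ hx))
    (fun hx hij => Subtype.ext (decompose_of_mem_ne ℳ hx hij))
    (by
      classical
      refine eq_top_iff.2 fun x _ => ?_
      have hx : x = ∑ i ∈ (decompose ℳ (x : X)).support,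
          (⟨decompose ℳ (x : X) i, hW i x.2⟩ : W) := by
        refine Subtype.ext ?_
        rw [AddSubmonoidClass.coe_finsetSum]
        exact (sum_support_decompose ℳ (x : X)).symm
      rw [hx]
      exact Submodule.sum_mem _ fun i _ =>
        Submodule.mem_iSup_of_mem (p := subGrading ℳ W) i (decompose ℳ (x : X) i).2)

variable {ℳ} [SetLike.GradedSMul 𝒜 ℳ] (D : DGPoissonModule S ℳ)

/-- A DG Poisson submodule as a DG Poisson module. -/
noncomputable def restrict (hW : D.IsDGPoissonSubmodule W) :
    letI := subDecomposition ℳ hW.isHomogeneous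
    DGPoissonModule S (subGrading ℳ W) :=
  letI := subDecomposition ℳ hW.isHomogeneous
  { d := D.d.restrict (p := W.restrictScalars k) (q := W.restrictScalars k) hW.d_mem
    br :=
      { toFun a := (D.br a).restrict (p := W.restrictScalars k) (q := W.restrictScalars k)
          (hW.br_mem a)
        map_add' a b := by
          ext x
          exact congrArg (fun f => f (x : X)) (D.br.map_add a b)
        map_smul' c a := by
          ext x
          exact congrArg (fun f => f (x : X)) (D.br.map_smul c a) }
    d_mem hm := D.d_mem hm
    br_mem ha hm := D.br_mem ha hm
    d_d m := Subtype.ext (D.d_d m)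
    d_smul ha hm := Subtype.ext (D.d_smul ha hm)
    br_smul ha hb hm := Subtype.ext (D.br_smul ha hb hm)
    mul_br ha hb hm := Subtype.ext (D.mul_br ha hb hm)
    br_br ha hb hm := Subtype.ext (D.br_br ha hb hm)
    d_br ha hm := Subtype.ext (D.d_br ha hm) }

/-- A DG Poisson submodule of a DG Poisson submodule is a DG Poisson submodule. -/
theorem isDGPoissonSubmodule_map_subtype (hW : D.IsDGPoissonSubmodule W) {N : Submodule A W}
    (hN : letI := subDecomposition ℳ hW.isHomogeneous; (D.restrict hW).IsDGPoissonSubmodule N) :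
    D.IsDGPoissonSubmodule (N.map W.subtype) := by
  let _ := subDecomposition ℳ hW.isHomogeneous
  refine ⟨?_, ?_, ?_⟩
  · rintro i _ ⟨x, hx, rfl⟩
    exact ⟨_, hN.isHomogeneous i hx,
      (coe_decompose_map (ℳ := subGrading ℳ W) (𝒩 := ℳ) (W.subtype.restrictScalars k)
        (fun h => h) x i).symm⟩
  · rintro _ ⟨x, hx, rfl⟩
    exact ⟨_, hN.d_mem x hx, rfl⟩
  · rintro a _ ⟨x, hx, rfl⟩
    exact ⟨_, hN.br_mem a x hx, rfl⟩

end Sub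

section Quotient

/-- The map induced on the quotient by a `k`-linear map which preserves an `A`-submodule. -/
def quotMap {L : Submodule A X} (f : X →ₗ[k] X) (hf : ∀ x ∈ L, f x ∈ L) : X ⧸ L →ₗ[k] X ⧸ L :=
  (Submodule.Quotient.restrictScalarsEquiv k L).toLinearMap ∘ₗ
    (L.restrictScalars k).mapQ (L.restrictScalars k) f hf ∘ₗ
    (Submodule.Quotient.restrictScalarsEquiv k L).symm.toLinearMap

theorem quotMap_mkQ {L : Submodule A X} (f : X →ₗ[k] X) (hf : ∀ x ∈ L, f x ∈ L) (x : X) :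
    quotMap f hf (L.mkQ x) = L.mkQ (f x) := rfl

/-- The bilinear map induced on the quotient. -/
def quotMap₂ {L : Submodule A X} (f : A →ₗ[k] X →ₗ[k] X) (hf : ∀ a, ∀ x ∈ L, f a x ∈ L) :
    A →ₗ[k] X ⧸ L →ₗ[k] X ⧸ L where
  toFun a := quotMap (f a) (hf a)
  map_add' a b := by
    refine LinearMap.ext fun x => ?_
    obtain ⟨x, rfl⟩ := L.mkQ_surjective x
    rw [LinearMap.add_apply, quotMap_mkQ, quotMap_mkQ, quotMap_mkQ, map_add, LinearMap.add_apply,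
      map_add]
  map_smul' c a := by
    refine LinearMap.ext fun x => ?_
    obtain ⟨x, rfl⟩ := L.mkQ_surjective x
    rw [LinearMap.smul_apply, quotMap_mkQ, quotMap_mkQ, map_smul, LinearMap.smul_apply]
    rfl

theorem quotMap₂_mkQ {L : Submodule A X} (f : A →ₗ[k] X →ₗ[k] X)
    (hf : ∀ a, ∀ x ∈ L, f a x ∈ L) (a : A) (x : X) :
    quotMap₂ f hf a (L.mkQ x) = L.mkQ (f a x) := rfl

variable (ℳ : ℤ → Submodule k X) (L : Submodule A X)

/-- The grading induced on a quotient. -/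
def quotGrading (i : ℤ) : Submodule k (X ⧸ L) := (ℳ i).map (L.mkQ.restrictScalars k)

variable {ℳ L} in
theorem mk_mem_quotGrading {i : ℤ} {x : X} (hx : x ∈ ℳ i) :
    (Submodule.Quotient.mk x : X ⧸ L) ∈ quotGrading ℳ L i := ⟨x, hx, rfl⟩

instance [SetLike.GradedSMul 𝒜 ℳ] : SetLike.GradedSMul 𝒜 (quotGrading ℳ L) where
  smul_mem := by
    rintro i j a _ ha ⟨x, hx, rfl⟩
    exact ⟨a • x, SetLike.GradedSMul.smul_mem ha hx, rfl⟩

variable [Decomposition ℳ] {L}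

/-- The decomposition of the quotient by a homogeneous submodule. -/
@[reducible]
noncomputable def quotDecomposition (hL : L.IsHomogeneous ℳ) :
    Decomposition (quotGrading ℳ L) :=
  .ofProj _ (fun i => quotMap (componentMap ℳ i) fun _ hx => hL i hx)
    (by
      rintro i _ ⟨x, hx, rfl⟩
      exact congrArg (Submodule.Quotient.mk (p := L)) (decompose_of_mem_same ℳ hx))
    (by
      rintro i j _ ⟨x, hx, rfl⟩ hij
      exact congrArg (Submodule.Quotient.mk (p := L)) (decompose_of_mem_ne ℳ hx hij))
    (by
      refine eq_top_iff.2 ?_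
      rintro x -
      obtain ⟨x, rfl⟩ := Submodule.Quotient.mk_surjective L x
      induction x using Decomposition.inductionOn ℳ with
      | zero => exact Submodule.zero_mem _
      | @homogeneous i x =>
        exact Submodule.mem_iSup_of_mem (p := quotGrading ℳ L) i (mk_mem_quotGrading x.2)
      | add x y hx hy => exact Submodule.add_mem _ hx hy)

variable {ℳ} [SetLike.GradedSMul 𝒜 ℳ] (D : DGPoissonModule S ℳ)

/-- The quotient of a DG Poisson module by a DG Poisson submodule. -/
noncomputable def quotient (hL : D.IsDGPoissonSubmodule L) :
    letI := quotDecomposition ℳ hL.isHomogeneous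
    DGPoissonModule S (quotGrading ℳ L) :=
  letI := quotDecomposition ℳ hL.isHomogeneous
  { d := quotMap D.d hL.d_mem
    br := quotMap₂ D.br hL.br_mem
    d_mem := by
      rintro i _ ⟨x, hx, rfl⟩
      exact mk_mem_quotGrading (D.d_mem hx)
    br_mem := by
      rintro i j a _ ha ⟨x, hx, rfl⟩
      exact mk_mem_quotGrading (D.br_mem ha hx)
    d_d m := by
      obtain ⟨x, rfl⟩ := L.mkQ_surjective m
      rw [quotMap_mkQ, quotMap_mkQ, D.d_d, map_zero]
    d_smul := by
      rintro i j a _ ha ⟨x, hx, rfl⟩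
      have h := congrArg L.mkQ (D.d_smul ha hx)
      simpa only [LinearMap.coe_restrictScalars, quotMap_mkQ, quotMap₂_mkQ, ← map_smul,
        map_add, Units.smul_def, map_zsmul] using h
    br_smul := by
      rintro i j l a b _ ha hb ⟨x, hx, rfl⟩
      have h := congrArg L.mkQ (D.br_smul ha hb hx)
      simpa only [LinearMap.coe_restrictScalars, quotMap_mkQ, quotMap₂_mkQ, ← map_smul,
        map_add, Units.smul_def, map_zsmul] using h
    mul_br := by
      rintro i j l a b _ ha hb ⟨x, hx, rfl⟩
      have h := congrArg L.mkQ (D.mul_br ha hb hx)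
      simpa only [LinearMap.coe_restrictScalars, quotMap_mkQ, quotMap₂_mkQ, ← map_smul,
        map_add, Units.smul_def, map_zsmul] using h
    br_br := by
      rintro i j l a b _ ha hb ⟨x, hx, rfl⟩
      have h := congrArg L.mkQ (D.br_br ha hb hx)
      simpa only [LinearMap.coe_restrictScalars, quotMap_mkQ, quotMap₂_mkQ, ← map_smul,
        map_add, Units.smul_def, map_zsmul] using h
    d_br := by
      rintro i j a _ ha ⟨x, hx, rfl⟩
      have h := congrArg L.mkQ (D.d_br ha hx)
      simpa only [LinearMap.coe_restrictScalars, quotMap_mkQ, quotMap₂_mkQ, ← map_smul,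
        map_add, Units.smul_def, map_zsmul] using h }

/-- The preimage of a DG Poisson submodule of a quotient is a DG Poisson submodule. -/
theorem isDGPoissonSubmodule_comap_mkQ (hL : D.IsDGPoissonSubmodule L) {N : Submodule A (X ⧸ L)}
    (hN : letI := quotDecomposition ℳ hL.isHomogeneous; (D.quotient hL).IsDGPoissonSubmodule N) :
    D.IsDGPoissonSubmodule (N.comap L.mkQ) := by
  let _ := quotDecomposition ℳ hL.isHomogeneous
  refine ⟨fun i x hx => ?_, fun x hx => hN.d_mem _ hx, fun a x hx => hN.br_mem a _ hx⟩
  have h := hN.isHomogeneous i hx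
  rwa [show L.mkQ x = L.mkQ.restrictScalars k x from rfl,
    coe_decompose_map (ℳ := ℳ) (L.mkQ.restrictScalars k) mk_mem_quotGrading x i] at h

end Quotient

variable {ℳ : ℤ → Submodule k X} [Decomposition ℳ] [SetLike.GradedSMul 𝒜 ℳ]
  (D : DGPoissonModule S ℳ)

theorem isDGPoissonSubmodule_bot : D.IsDGPoissonSubmodule ⊥ where
  isHomogeneous i x hx := by
    rw [(Submodule.mem_bot A).1 hx]
    simp
  d_mem m hm := by
    rw [(Submodule.mem_bot A).1 hm, map_zero]
    exact Submodule.zero_mem _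
  br_mem a m hm := by
    rw [(Submodule.mem_bot A).1 hm, map_zero]
    exact Submodule.zero_mem _

/-- The supremum of a nonempty chain is its union, and each closure condition concerns one element
of the submodule at a time. -/
theorem isDGPoissonSubmodule_sSup_of_isChain {c : Set (Submodule A X)}
    (hc : IsChain (· ≤ ·) c) (hne : c.Nonempty) (h : ∀ N ∈ c, D.IsDGPoissonSubmodule N) :
    D.IsDGPoissonSubmodule (sSup c) := by
  have hmem : ∀ x : X, x ∈ sSup c ↔ ∃ N ∈ c, x ∈ N := fun x =>
    Submodule.mem_sSup_of_directed hne hc.directedOn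
  refine ⟨fun i x hx => ?_, fun x hx => ?_, fun a x hx => ?_⟩ <;>
    obtain ⟨N, hN, hx⟩ := (hmem x).1 hx
  · exact (hmem _).2 ⟨N, hN, (h N hN).isHomogeneous i hx⟩
  · exact (hmem _).2 ⟨N, hN, (h N hN).d_mem x hx⟩
  · exact (hmem _).2 ⟨N, hN, (h N hN).br_mem a x hx⟩

/-- There is a DG Poisson submodule maximal among those which do not contain a given nonzero
element. -/
theorem exists_maximal_notMem {ψ : X} (hψ : ψ ≠ 0) :
    ∃ L : Submodule A X, Maximal (fun N => D.IsDGPoissonSubmodule N ∧ ψ ∉ N) L := by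
  obtain ⟨L, -, hL⟩ := zorn_le_nonempty₀ {N : Submodule A X | D.IsDGPoissonSubmodule N ∧ ψ ∉ N}
    (fun c hc hchain N hN => by
      refine ⟨sSup c, ⟨D.isDGPoissonSubmodule_sSup_of_isChain hchain ⟨N, hN⟩
        fun N hN => (hc hN).1, fun h => ?_⟩, fun N hN => le_sSup hN⟩
      obtain ⟨N', hN', h⟩ := (Submodule.mem_sSup_of_directed ⟨N, hN⟩ hchain.directedOn).1 h
      exact (hc hN').2 h)
    ⊥ ⟨D.isDGPoissonSubmodule_bot, by simpa using hψ⟩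
  exact ⟨L, hL⟩

end Subquotient

/-- If every nonzero DG Poisson submodule contains `ψ ≠ 0`, then the intersection of the nonzero
DG Poisson submodules is simple. -/
theorem exists_simple_submodule {k A : Type*} {X : Type u} [Field k] [Ring A] [Algebra k A]
    {𝒜 : ℤ → Submodule k A} [GradedAlgebra 𝒜] {S : DGPoisson 𝒜}
    [AddCommGroup X] [Module k X] [Module A X] [IsScalarTower k A X]
    {ℳ : ℤ → Submodule k X} [Decomposition ℳ] [SetLike.GradedSMul 𝒜 ℳ]
    (D : DGPoissonModule S ℳ) {ψ : X} (hψ : ψ ≠ 0)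
    (h : ∀ N, D.IsDGPoissonSubmodule N → N ≠ ⊥ → ψ ∈ N) :
    ∃ (W : Submodule A X) (hW : D.IsDGPoissonSubmodule W), ψ ∈ W ∧
      letI := subDecomposition ℳ hW.isHomogeneous
      (D.restrict hW).IsSimple := by
  let W := sInf {N : Submodule A X | D.IsDGPoissonSubmodule N ∧ N ≠ ⊥}
  have hW : D.IsDGPoissonSubmodule W := .sInf D fun N hN => hN.1
  have hψW : ψ ∈ W := Submodule.mem_sInf.2 fun N hN => h N hN.1 hN.2
  let _ := subDecomposition ℳ hW.isHomogeneous
  refine ⟨W, hW, hψW, ⟨⟨⟨ψ, hψW⟩, 0, fun h0 => hψ (congrArg Subtype.val h0)⟩, fun N hN => ?_⟩⟩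
  by_cases hbot : N = ⊥
  · exact .inl hbot
  · refine .inr (eq_top_iff.2 fun x _ => ?_)
    -- A nonzero DG Poisson submodule of `W`, viewed in `X`, is one of those whose intersection is
    -- `W`.
    have hle : W ≤ N.map W.subtype := sInf_le
      ⟨D.isDGPoissonSubmodule_map_subtype hW hN, fun h0 => hbot
        (Submodule.map_injective_of_injective W.injective_subtype 
          (h0.trans (Submodule.map_bot _).symm))⟩
    obtain ⟨y, hy, hyx⟩ := hle x.2
    rwa [← Subtype.ext hyx]

/-- A DG Poisson module with a nonzero closed homogeneous element killed by a maximal DG ideal `M`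
has a simple subquotient annihilated by the largest DG Poisson ideal in `M`. -/
theorem exists_simple_of_closed {k A : Type*} {X : Type u} [Field k] [Ring A] [Algebra k A]
    {𝒜 : ℤ → Submodule k A} [GradedAlgebra 𝒜] {S : DGPoisson 𝒜}
    [AddCommGroup X] [Module k X] [Module A X] [IsScalarTower k A X]
    {ℳ : ℤ → Submodule k X} [Decomposition ℳ] [SetLike.GradedSMul 𝒜 ℳ]
    (D : DGPoissonModule S ℳ) {M P : Ideal A} (hM : S.IsMaximalDGIdeal M)
    (hP : IsGreatest {Q : Ideal A | S.IsDGPoissonIdeal Q ∧ Q ≤ M} P)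
    {j : ℤ} {ψ : X} (hψ : ψ ∈ ℳ j) (hd : D.d ψ = 0) (hψ0 : ψ ≠ 0) (hMψ : ∀ a ∈ M, a • ψ = 0) :
    ∃ (X : Type u) (_ : AddCommGroup X) (_ : Module k X) (_ : Module A X)
      (_ : IsScalarTower k A X) (ℳ : ℤ → Submodule k X) (_ : Decomposition ℳ)
      (_ : SetLike.GradedSMul 𝒜 ℳ) (D : DGPoissonModule S ℳ),
      D.IsSimple ∧ P = Module.annihilator A X := by
  obtain ⟨L, hL⟩ := D.exists_maximal_notMem hψ0
  have hLD := hL.prop.1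
  let _ := quotDecomposition ℳ hLD.isHomogeneous
  have hψ' : (Submodule.Quotient.mk ψ : X ⧸ L) ≠ 0 := fun h =>
    hL.prop.2 ((Submodule.Quotient.mk_eq_zero L).1 h)
  obtain ⟨W, hW, hψW, hsimple⟩ := (D.quotient hLD).exists_simple_submodule hψ' fun N hN hbot => by
    by_contra hψN
    refine hbot ?_
    have hle : L ≤ N.comap L.mkQ := fun x hx => by
      rw [Submodule.mem_comap, Submodule.mkQ_apply, (Submodule.Quotient.mk_eq_zero L).2 hx]
      exact N.zero_mem
    -- If `N` missed the class of `ψ`, its preimage would contain `L` and miss `ψ`, so it would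
    -- equal `L` and `N` would be zero.
    have hEq := hL.eq_of_le ⟨D.isDGPoissonSubmodule_comap_mkQ hLD hN, hψN⟩ hle
    refine (Submodule.eq_bot_iff N).2 fun x hx => ?_
    obtain ⟨x, rfl⟩ := Submodule.Quotient.mk_surjective L x
    exact (Submodule.Quotient.mk_eq_zero L).2 (hEq ▸ hx)
  let _ := subDecomposition (quotGrading ℳ L) hW.isHomogeneous
  refine ⟨W, inferInstance, inferInstance, inferInstance, inferInstance,
    subGrading (quotGrading ℳ L) W, inferInstance, inferInstance,
    (D.quotient hLD).restrict hW, hsimple, ?_⟩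
  refine hsimple.annihilator_eq hM hP (ψ := ⟨Submodule.Quotient.mk ψ, hψW⟩) (j := j)
    (mk_mem_quotGrading hψ) (Subtype.ext ?_) (fun h => hψ' (congrArg Subtype.val h))
    fun a ha => Subtype.ext ?_
  · exact congrArg (Submodule.Quotient.mk (p := L)) hd
  · exact congrArg (Submodule.Quotient.mk (p := L)) (hMψ a ha)

end DGPoissonModule

/-! ### The graded dual of a DG Poisson algebra -/

namespace DGPoisson

variable {k A : Type*} [Field k] [Ring A] [Algebra k A] {𝒜 : ℤ → Submodule k A}

/-! ### Bracket identities that dualize to the module axioms -/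

section Identities

variable [GradedAlgebra 𝒜] (S : DGPoisson 𝒜)

/-- The right Leibniz rule. -/
theorem mul_br {i j l : ℤ} {a b c : A} (ha : a ∈ 𝒜 i) (hb : b ∈ 𝒜 j) (hc : c ∈ 𝒜 l) :
    S.br (a * b) c = a * S.br b c + (j * l).negOnePow • (S.br a c * b) := by
  rw [S.antisymm (SetLike.mul_mem_graded ha hb) hc, S.br_mul hc ha hb, S.antisymm hc ha,
    S.antisymm hc hb, add_mul, Int.negOnePow_add, mul_comm l i, mul_comm l j]
  -- Each remaining sign is $\pm1$; fixing its value leaves an identity without degrees.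
  rcases Int.units_eq_one_or (i * l).negOnePow with h | h <;>
  rcases Int.units_eq_one_or (j * l).negOnePow with h' | h' <;>
  simp [h, h']

/-- The right Jacobi identity. -/
theorem br_br_right {i j l : ℤ} {a b c : A} (ha : a ∈ 𝒜 i) (hb : b ∈ 𝒜 j) (hc : c ∈ 𝒜 l) :
    S.br (S.br a b) c = S.br a (S.br b c) + (j * l).negOnePow • S.br (S.br a c) b := by
  rw [S.jacobi ha hb hc, S.antisymm hb (S.br_mem ha hc), mul_add, Int.negOnePow_add,
    mul_comm j i]
  rcases Int.units_eq_one_or (i * j).negOnePow with h | h <;>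
  rcases Int.units_eq_one_or (j * l).negOnePow with h' | h' <;>
  simp [h, h']

/-- The right Leibniz rule solved for the term $\{a,b\}c$. Applying a functional to it, with `a` as
the argument, gives the axiom for $\{b,c\varphi\}$. -/
theorem br_mul_right {i j l : ℤ} {a b c : A} (ha : a ∈ 𝒜 i) (hb : b ∈ 𝒜 j) (hc : c ∈ 𝒜 l) :
    S.br a b * c = a * S.br b c + (j * l).negOnePow • S.br (a * c) b := by
  rw [S.mul_br ha hc hb, S.antisymm hb hc, mul_comm l j]
  rcases Int.units_eq_one_or (j * l).negOnePow with h | h <;> simp [h]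

/-- On expanding all three brackets, the terms $a\{b,c\}$ and $a\{c,b\}$ cancel by antisymmetry, and
graded commutativity matches $b\{a,c\}$ with $\{a,c\}b$. Its dual is the axiom for $\{bc,\varphi\}$.
-/
theorem br_mul_eq {i j l : ℤ} {a b c : A} (ha : a ∈ 𝒜 i) (hb : b ∈ 𝒜 j) (hc : c ∈ 𝒜 l) :
    S.br a (b * c) = S.br (a * b) c + (j * l).negOnePow • S.br (a * c) b := by
  rw [S.br_mul ha hb hc, S.mul_br ha hb hc, S.mul_br ha hc hb, S.comm hb (S.br_mem ha hc),
    S.antisymm hb hc, mul_add, Int.negOnePow_add, mul_comm j i, mul_comm l j]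
  rcases Int.units_eq_one_or (i * j).negOnePow with h | h <;>
  rcases Int.units_eq_one_or (j * l).negOnePow with h' | h' <;>
  simp [h, h'] <;> abel

end Identities

/-! ### The graded dual as a DG Poisson module -/

section GradedDual

variable (𝒜) in
/-- The functionals of degree `n`: those vanishing on `𝒜 i` for `i ≠ -n`. -/
def dualPiece (n : ℤ) : Submodule k (A →ₗ[k] k) where
  carrier := {φ | ∀ i : ℤ, i + n ≠ 0 → ∀ a ∈ 𝒜 i, φ a = 0}
  zero_mem' _ _ _ _ := rfl
  add_mem' hφ hφ' i hi a ha := by rw [LinearMap.add_apply, hφ i hi a ha, hφ' i hi a ha, add_zero]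
  smul_mem' c φ hφ i hi a ha := by rw [LinearMap.smul_apply, hφ i hi a ha, smul_zero]

variable (𝒜) in
/-- The graded dual: the functionals which are sums of homogeneous functionals. -/
def gradedDual : Submodule k (A →ₗ[k] k) := ⨆ n, dualPiece 𝒜 n

theorem mem_gradedDual_of_mem_dualPiece {n : ℤ} {φ : A →ₗ[k] k} (h : φ ∈ dualPiece 𝒜 n) :
    φ ∈ gradedDual 𝒜 := Submodule.mem_iSup_of_mem n h

variable (𝒜) in
/-- The underlying type of the graded dual. -/
def GradedDual : Type _ := gradedDual 𝒜

noncomputable instance : AddCommGroup (GradedDual 𝒜) :=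
  inferInstanceAs (AddCommGroup (gradedDual 𝒜))

noncomputable instance : Module k (GradedDual 𝒜) :=
  inferInstanceAs (Module k (gradedDual 𝒜))

variable (𝒜) in
/-- The inclusion of the graded dual into the dual. -/
def GradedDual.subtype : GradedDual 𝒜 →ₗ[k] A →ₗ[k] k where
  toFun φ := φ.1
  map_add' _ _ := rfl
  map_smul' _ _ := rfl

variable (𝒜) in
theorem GradedDual.range_subtype : LinearMap.range (GradedDual.subtype 𝒜) = gradedDual 𝒜 :=
  SetLike.coe_injective Subtype.range_coe

/-- The endomorphism of the graded dual given by precomposition with `f`. -/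
def GradedDual.comp (f : A →ₗ[k] A) (hf : ∀ φ ∈ gradedDual 𝒜, φ ∘ₗ f ∈ gradedDual 𝒜) :
    GradedDual 𝒜 →ₗ[k] GradedDual 𝒜 where
  toFun φ := ⟨φ.1 ∘ₗ f, hf φ.1 φ.2⟩
  map_add' _ _ := rfl
  map_smul' _ _ := rfl

theorem gradedDual_add_apply (φ φ' : GradedDual 𝒜) (a : A) :
    (φ + φ').1 a = φ.1 a + φ'.1 a := rfl

theorem gradedDual_units_smul_apply (ε : ℤˣ) (φ : GradedDual 𝒜) (a : A) :
    (ε • φ).1 a = ε • φ.1 a := rfl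

theorem gradedDual_map_units_smul (ε : ℤˣ) (φ : GradedDual 𝒜) (a : A) :
    φ.1 (ε • a) = ε • φ.1 a := by
  rw [Units.smul_def, map_zsmul, Units.smul_def]

/-- Precomposition with a homogeneous endomorphism shifts the degree of a functional. -/
theorem comp_mem_dualPiece {c n m : ℤ} {f : A →ₗ[k] A} (hf : ∀ i, ∀ a ∈ 𝒜 i, f a ∈ 𝒜 (i + c))
    (hm : c + n = m) {φ : A →ₗ[k] k} (hφ : φ ∈ dualPiece 𝒜 n) :
    φ ∘ₗ f ∈ dualPiece 𝒜 m := fun i hi a ha =>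
  hφ (i + c) (by rwa [add_assoc, hm]) _ (hf i a ha)

variable [GradedAlgebra 𝒜]

theorem gradedDual_ext {φ φ' : GradedDual 𝒜}
    (h : ∀ (i : ℤ) (a : A), a ∈ 𝒜 i → φ.1 a = φ'.1 a) : φ = φ' := by
  refine Subtype.ext (LinearMap.ext fun a => ?_)
  induction a using Decomposition.inductionOn 𝒜 with
  | zero => simp
  | homogeneous a => exact h _ _ a.2
  | add x y hx hy => rw [map_add, map_add, hx, hy]

theorem comp_mem_gradedDual {c : ℤ} {f : A →ₗ[k] A} (hf : ∀ i, ∀ a ∈ 𝒜 i, f a ∈ 𝒜 (i + c))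
    {φ : A →ₗ[k] k} (hφ : φ ∈ gradedDual 𝒜) : φ ∘ₗ f ∈ gradedDual 𝒜 := by
  have h : gradedDual 𝒜 ≤ (gradedDual 𝒜).comap (LinearMap.lcomp k k f) := iSup_le fun n φ hφ =>
    mem_gradedDual_of_mem_dualPiece (comp_mem_dualPiece hf rfl hφ)
  exact h hφ

/-- Precomposition with an endomorphism depending linearly on an element of `A`, homogeneous of
degree `0` in both arguments, preserves the graded dual. -/
theorem comp_apply_mem_gradedDual {f : A →ₗ[k] A →ₗ[k] A}
    (hf : ∀ {i j : ℤ} {a b : A}, a ∈ 𝒜 i → b ∈ 𝒜 j → f b a ∈ 𝒜 (i + j)) (b : A)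
    {φ : A →ₗ[k] k} (hφ : φ ∈ gradedDual 𝒜) : φ ∘ₗ f b ∈ gradedDual 𝒜 := by
  induction b using Decomposition.inductionOn 𝒜 with
  | zero => rw [map_zero, LinearMap.comp_zero]; exact zero_mem _
  | homogeneous b => exact comp_mem_gradedDual (fun i a ha => hf ha b.2) hφ
  | add x y hx hy => rw [map_add, LinearMap.comp_add]; exact add_mem hx hy

/-- `A` acts on its graded dual by `(b • φ) a = φ (a * b)`. -/
noncomputable instance : Module A (GradedDual 𝒜) where
  smul b φ := ⟨φ.1 ∘ₗ (LinearMap.mul k A).flip b,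
    comp_apply_mem_gradedDual (fun ha hb => SetLike.mul_mem_graded ha hb) b φ.2⟩
  one_smul φ := Subtype.ext (LinearMap.ext fun a => congrArg φ.1 (mul_one a))
  mul_smul b c φ := Subtype.ext (LinearMap.ext fun a => congrArg φ.1 (mul_assoc a b c).symm)
  smul_zero _ := rfl
  smul_add _ _ _ := rfl
  add_smul b c φ := Subtype.ext (LinearMap.ext fun a =>
    (congrArg φ.1 (mul_add a b c)).trans (map_add _ _ _))
  zero_smul φ := Subtype.ext (LinearMap.ext fun a =>
    (congrArg φ.1 (mul_zero a)).trans (map_zero _))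

theorem smul_gradedDual_apply (b : A) (φ : GradedDual 𝒜) (a : A) : (b • φ).1 a = φ.1 (a * b) := rfl

instance : IsScalarTower k A (GradedDual 𝒜) where
  smul_assoc c b φ := Subtype.ext (LinearMap.ext fun a => by
    rw [smul_gradedDual_apply, mul_smul_comm, map_smul]
    rfl)

variable (𝒜) in
/-- The grading of the graded dual. -/
noncomputable def dualGrading (n : ℤ) : Submodule k (GradedDual 𝒜) :=
  (dualPiece 𝒜 n).comap (GradedDual.subtype 𝒜)

instance : SetLike.GradedSMul 𝒜 (dualGrading 𝒜) where
  smul_mem {_ _ b _} hb hφ :=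
    comp_mem_dualPiece (f := (LinearMap.mul k A).flip b)
      (fun _ _ ha => SetLike.mul_mem_graded ha hb) rfl hφ

/-- The degree `n` part of a functional is its composite with the projection of `A` to degree `-n`.
The pieces span because the graded dual is by definition their sum inside the full dual. -/
noncomputable instance : Decomposition (dualGrading 𝒜) :=
  .ofProj (dualGrading 𝒜) (fun n => GradedDual.comp (componentMap 𝒜 (-n)) fun φ hφ =>
        comp_mem_gradedDual (c := 0) (fun i a ha => by
          rw [componentMap_apply, add_zero]
          by_cases h : i = -n
          · subst h
            exact (decompose 𝒜 a _).2
          · rw [decompose_of_mem_ne 𝒜 ha h]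
            exact zero_mem _) hφ)
    (fun {n φ} hφ => gradedDual_ext fun i a ha => by
      change φ.1 (decompose 𝒜 a (-n)) = φ.1 a
      by_cases h : i = -n
      · subst h
        rw [decompose_of_mem_same 𝒜 ha]
      · rw [decompose_of_mem_ne 𝒜 ha h, map_zero]
        exact (hφ i (by lia) a ha).symm)
    (fun {n m φ} hφ hmn => gradedDual_ext fun i a ha => by
      change φ.1 (decompose 𝒜 a (-n)) = 0
      exact hφ (-n) (by lia) _ (decompose 𝒜 a (-n)).2)
    (by
      refine Submodule.map_injective_of_injective (f := GradedDual.subtype 𝒜)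
        Subtype.val_injective ?_
      rw [Submodule.map_iSup, Submodule.map_top, GradedDual.range_subtype]
      refine iSup_congr fun n => ?_
      rw [dualGrading, Submodule.map_comap_eq, GradedDual.range_subtype, inf_eq_right]
      exact fun φ hφ => mem_gradedDual_of_mem_dualPiece hφ)

variable (𝒜) in
/-- The parity involution, which is `(-1) ^ i` on `𝒜 i`. -/
noncomputable def parity : A →ₗ[k] A :=
  DirectSum.toModule k ℤ A (fun i => (i.negOnePow : ℤ) • (𝒜 i).subtype) ∘ₗ
    (decomposeLinearEquiv 𝒜).toLinearMap

theorem parity_of_mem {i : ℤ} {a : A} (ha : a ∈ 𝒜 i) : parity 𝒜 a = i.negOnePow • a := by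
  rw [parity, LinearMap.comp_apply, LinearEquiv.coe_coe, decomposeLinearEquiv_apply,
    decompose_of_mem 𝒜 ha, ← DirectSum.lof_eq_of k, toModule_lof, Units.smul_def]
  rfl

variable (S : DGPoisson 𝒜)

theorem d_parity_mem (i : ℤ) (a : A) (ha : a ∈ 𝒜 i) : (S.d ∘ₗ parity 𝒜) a ∈ 𝒜 (i + 1) := by
  rw [LinearMap.comp_apply, parity_of_mem ha, Units.smul_def, map_zsmul]
  exact zsmul_mem (S.d_mem ha) _

/-- The differential of the graded dual: `(d φ) a = -(-1) ^ |a| φ (d a)`. -/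
noncomputable def dualD : GradedDual 𝒜 →ₗ[k] GradedDual 𝒜 :=
  -- The sign is read off the argument through `parity`. For `φ` of degree `n`, $\varphi(da)$ can be
  -- nonzero only if $|a|=-n-1$, so this is $(-1)^n\varphi\circ d$.
  -GradedDual.comp (S.d ∘ₗ parity 𝒜) fun _ hφ => comp_mem_gradedDual S.d_parity_mem hφ

theorem dualD_apply (φ : GradedDual 𝒜) {i : ℤ} {a : A} (ha : a ∈ 𝒜 i) :
    (S.dualD φ).1 a = -(i.negOnePow • φ.1 (S.d a)) := by
  change -(φ.1 (S.d (parity 𝒜 a))) = _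
  rw [parity_of_mem ha, Units.smul_def, map_zsmul, map_zsmul, Units.smul_def]

/-- The bracket of the graded dual: `{b, φ} a = φ {a, b}`. -/
noncomputable def dualBr : A →ₗ[k] GradedDual 𝒜 →ₗ[k] GradedDual 𝒜 where
  toFun b := GradedDual.comp (S.br.flip b) fun _ hφ =>
    comp_apply_mem_gradedDual (f := S.br.flip) (fun ha hb => S.br_mem ha hb) b hφ
  map_add' b c := LinearMap.ext fun φ => Subtype.ext (LinearMap.ext fun a =>
    (congrArg φ.1 ((S.br a).map_add b c)).trans (map_add _ _ _))
  map_smul' r b := LinearMap.ext fun φ => Subtype.ext (LinearMap.ext fun a =>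
    (congrArg φ.1 ((S.br a).map_smul r b)).trans (map_smul _ _ _))

theorem dualBr_apply (b : A) (φ : GradedDual 𝒜) (a : A) :
    (S.dualBr b φ).1 a = φ.1 (S.br a b) := rfl

/-- The graded dual of a DG Poisson algebra is a DG Poisson module. -/
noncomputable def dualModule : DGPoissonModule S (dualGrading 𝒜) where
  d := S.dualD
  br := S.dualBr
  d_mem {n φ} hφ := by
    refine Submodule.neg_mem (dualPiece 𝒜 (n + 1)) ?_
    exact comp_mem_dualPiece S.d_parity_mem (add_comm _ _) hφ
  br_mem {_ _ b _} hb hφ :=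
    comp_mem_dualPiece (f := S.br.flip b) (fun _ _ ha => S.br_mem ha hb) rfl hφ
  d_d φ := gradedDual_ext fun i a ha => by
    rw [S.dualD_apply _ ha, S.dualD_apply _ (S.d_mem ha), S.d_d, map_zero, smul_zero, neg_zero,
      smul_zero, neg_zero]
    rfl
  d_smul {j _ b φ} hb _ := gradedDual_ext fun i a ha => by
    rw [S.dualD_apply _ ha, gradedDual_add_apply, gradedDual_units_smul_apply,
      smul_gradedDual_apply, smul_gradedDual_apply, smul_gradedDual_apply,
      S.dualD_apply _ (SetLike.mul_mem_graded ha hb), S.d_mul ha hb, map_add,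
      gradedDual_map_units_smul, Int.negOnePow_add]
    rcases Int.units_eq_one_or i.negOnePow with h | h <;>
    rcases Int.units_eq_one_or j.negOnePow with h' | h' <;>
    simp [h, h']
  br_smul {_ _ _ b c φ} hb hc _ := gradedDual_ext fun i a ha => by
    rw [gradedDual_add_apply, gradedDual_units_smul_apply, S.dualBr_apply, smul_gradedDual_apply,
      smul_gradedDual_apply, smul_gradedDual_apply, S.dualBr_apply, S.br_mul_right ha hb hc,
      map_add, gradedDual_map_units_smul]
  mul_br {_ _ _ b c φ} hb hc _ := gradedDual_ext fun i a ha => by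
    rw [gradedDual_add_apply, gradedDual_units_smul_apply, S.dualBr_apply, smul_gradedDual_apply,
      smul_gradedDual_apply, S.dualBr_apply, S.dualBr_apply, S.br_mul_eq ha hb hc,
      map_add, gradedDual_map_units_smul]
  br_br {_ _ _ b c φ} hb hc _ := gradedDual_ext fun i a ha => by
    rw [gradedDual_add_apply, gradedDual_units_smul_apply, S.dualBr_apply, S.dualBr_apply,
      S.dualBr_apply, S.dualBr_apply, S.dualBr_apply, S.br_br_right ha hb hc,
      map_add, gradedDual_map_units_smul]
  d_br {j _ b φ} hb _ := gradedDual_ext fun i a ha => by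
    rw [S.dualD_apply _ ha, gradedDual_add_apply, gradedDual_units_smul_apply,
      S.dualBr_apply, S.dualBr_apply, S.dualBr_apply,
      S.dualD_apply _ (S.br_mem ha hb), S.d_br ha hb, map_add,
      gradedDual_map_units_smul, Int.negOnePow_add]
    rcases Int.units_eq_one_or i.negOnePow with h | h <;>
    rcases Int.units_eq_one_or j.negOnePow with h' | h' <;>
    simp [h, h']

/-- The graded dual contains a nonzero closed homogeneous element killed by any given proper DG
ideal. -/
theorem exists_closed_dual {M : Ideal A} (hM : S.IsDGIdeal M) (hM1 : M ≠ ⊤) :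
    ∃ (j : ℤ) (ψ : GradedDual 𝒜), ψ ∈ dualGrading 𝒜 j ∧ S.dualModule.d ψ = 0 ∧ ψ ≠ 0 ∧
      ∀ a ∈ M, a • ψ = 0 := by
  have := hM.isTwoSided
  obtain ⟨f, hf1, hfM⟩ := Submodule.exists_le_ker_of_notMem (p := M.restrictScalars k)
    (v := (1 : A)) fun h => hM1 ((Ideal.eq_top_iff_one M).2 h)
  -- `f` need not lie in the graded dual, but its degree `0` part does. That part still kills `M`,
  -- which is homogeneous, and agrees with `f` at `1`, which has degree `0`.
  have hφ0 : f ∘ₗ componentMap 𝒜 0 ∈ dualPiece 𝒜 0 := fun i hi a ha => by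
    rw [LinearMap.comp_apply, componentMap_apply,
      decompose_of_mem_ne 𝒜 ha (by simpa using hi), map_zero]
  let φ : GradedDual 𝒜 := ⟨f ∘ₗ componentMap 𝒜 0, mem_gradedDual_of_mem_dualPiece hφ0⟩
  have hφM : ∀ a ∈ M, φ.1 a = 0 := fun a ha => hfM (hM.isHomogeneous 0 ha)
  have hφ1 : φ ≠ 0 := fun h => hf1 <| by
    have h1 : f (decompose 𝒜 (1 : A) 0) = 0 := congrArg (fun φ : GradedDual 𝒜 => φ.1 1) h
    rwa [decompose_of_mem_same 𝒜 SetLike.GradedOne.one_mem] at h1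
  by_cases hd : S.dualD φ = 0
  · exact ⟨0, φ, hφ0, hd, hφ1, fun b hb => gradedDual_ext fun i a _ =>
      hφM _ (M.mul_mem_left a hb)⟩
  · refine ⟨0 + 1, S.dualD φ, S.dualModule.d_mem hφ0, S.dualModule.d_d φ, hd, fun b hb =>
      DGPoissonModule.mem_killedBy_of_homogeneous (𝒜 := 𝒜) (I := M) hM.isHomogeneous ?_ b hb⟩
    refine fun j b hbj hb => gradedDual_ext fun i a ha => ?_
    -- The value is $\pm\varphi(d(ab))$, and $d(ab)\in M$ because `M` is an ideal stable under $d$.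
    rw [smul_gradedDual_apply, S.dualD_apply _ (SetLike.mul_mem_graded ha hbj),
      hφM _ (hM.d_mem _ (M.mul_mem_left a hb)), smul_zero, neg_zero]
    rfl

end GradedDual

end DGPoisson

/-! ### The main theorem

The simple module is a subquotient of the graded dual of `A`; this works for every DG Poisson algebra,
so the presentation of `A` as an image of `R` is not used. -/

theorem mainTheorem4 {k : Type u} [Field k]
    -- the polynomial DG Poisson algebra `R`
    {Λ : Type v} (deg : Λ → ℤ) (SR : DGPoisson (GradedPoly.grading k deg))
    -- the DG Poisson algebra `A`
    {A : Type w} [Ring A] [Algebra k A] (𝒜 : ℤ → Submodule k A) [GradedAlgebra 𝒜]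
    (SA : DGPoisson 𝒜)
    -- `A` is a DG Poisson homomorphic image of `R`
    (π : GradedPoly k deg →ₐ[k] A) (hπ : SR.IsHom SA π) (hsurj : Function.Surjective π)
    (P : Ideal A) (hP : SA.IsSymplectic P) :
    ∃ (X : Type (max u w)) (_ : AddCommGroup X) (_ : Module k X) (_ : Module A X)
      (_ : IsScalarTower k A X) (ℳ : ℤ → Submodule k X) (_ : DirectSum.Decomposition ℳ)
      (_ : SetLike.GradedSMul 𝒜 ℳ) (D : DGPoissonModule SA ℳ),
      D.IsSimple ∧ P = Module.annihilator A X := by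
  obtain ⟨M, hM, hPM⟩ := hP
  obtain ⟨j, ψ, hψ, hd, hψ0, hMψ⟩ := SA.exists_closed_dual hM.prop.1 hM.prop.2
  exact SA.dualModule.exists_simple_of_closed hM hPM hψ hd hψ0 hMψ
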